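/- Let $G=(V,E)$ be an infinite graph, not necessarily connected or locally finite. A ray is a one-way infinite path; an end of $G$ is a class of rays under the equivalence in which two rays are equivalent if, for every finite $T\subseteq V$, both have a tail in the same component of $G-T$. A ray in the class $\omega$ is called an $\omega$-ray. A separation of a graph with vertex set $W$ is an ordered pair $(A,B)$ with $A\cup B=W$ such that there is no edge between $A\setminus B$ and $B\setminus A$; its order is $|A\cap B|$. Let $\vec S$ be the set of all separations of $G$ of finite order and, for a cardinal $k$, let $\vec S_k\subseteq\vec S$ be the set of those of order $<k$. Give $\vec S$ the topology with the basic open sets $\{(A,B)\in\vec S : A\cap Z=A',\ B\cap Z=B'\}$, where $Z\subseteq V$ is finite and $(A',B')$ is a separation of $G[Z]$. For an end $\omega$ of $G$ let $\tau_\omega=\{(A,B)\in\vec S : \text{every } \omega\text{-ray has a tail in } B\}$, and let the cohesion of $\omega$ be $$\operatorname{coh}(\omega)=\sup\{\kappa\le\aleph_1 : \tau_\omega\cap\vec S_k \text{ is closed in } \vec S \text{ for all cardinals } k<\kappa\}.$$ Let $\deg(\omega)\in\mathbb N\cup\{\infty\}$ be the largest size (supremum of the sizes) of a family of pairwise disjoint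 $\omega$-rays. A vertex $v$ dominates $\omega$ if, for some $\omega$-ray $R$, there are infinitely many paths from $v$ to vertices of $R$ other than $v$ which are pairwise disjoint except at $v$. Let $\operatorname{dom}(\omega)\in\mathbb N\cup\{\infty\}$ be the number of vertices that dominate $\omega$. Then for every end $\omega$ of $G$: (i) $\omega$ has infinite cohesion (that is, $\operatorname{coh}(\omega)=\aleph_1$; equivalently, $\tau_\omega$ is closed in $\vec S$) if and only if $\operatorname{dom}(\omega)=\infty$. (ii) $\omega$ has unbounded cohesion (that is, $\operatorname{coh}(\omega)=\aleph_0$; equivalently, $\tau_\omega$ is not closed in $\vec S$, but $\tau_\omega\cap\vec S_k$ is for every $k\in\mathbb N$) if and only if $\deg(\omega)=\infty$ and $\operatorname{dom}(\omega)<\infty$. (iii) For every $k\in\mathbb N$, $\omega$ has bounded cohesion $\operatorname{coh}(\omega)=k$ if and only if $\deg(\omega)+\operatorname{dom}(\omega)=k-1$. -/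

import Mathlib

universe u

namespace GraphEnd

variable {V : Type u}

/-- A ray of `G`: a one-way infinite path `v₀ v₁ v₂ …`, listed from its start-vertex. -/
structure Ray (G : SimpleGraph V) where
  vert : ℕ → V
  injective : Function.Injective vert
  adj : ∀ n, G.Adj (vert n) (vert (n + 1))

/-- The vertex set of a ray. -/
def Ray.verts {G : SimpleGraph V} (R : Ray G) : Set V := Set.range R.vert

/-- `R` has a tail in the vertex set `B`. -/
def Ray.HasTailIn {G : SimpleGraph V} (R : Ray G) (B : Set V) : Prop :=
  ∃ N, ∀ n, N ≤ n → R.vert n ∈ B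

/-- Two rays are equivalent if, for every finite set `T` of vertices, both have a tail in the
same component of `G - T`. -/
def Ray.Equivalent {G : SimpleGraph V} (R R' : Ray G) : Prop :=
  ∀ T : Set V, T.Finite → ∃ C : G.ComponentCompl T,
    R.HasTailIn (C : Set V) ∧ R'.HasTailIn (C : Set V)

theorem Ray.Equivalent.refl {G : SimpleGraph V} (R : Ray G) : R.Equivalent R := by
  intro T hT
  obtain ⟨N, hN⟩ : ∃ N, ∀ n, N ≤ n → R.vert n ∉ T := by
    obtain ⟨M, hM⟩ := (hT.preimage R.injective.injOn).bddAbove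
    exact ⟨M + 1, fun n hn h => absurd (hM h) (by omega)⟩
  refine ⟨G.componentComplMk (hN N le_rfl), ?_⟩
  have key : ∀ n, N ≤ n → R.vert n ∈ (G.componentComplMk (hN N le_rfl) : Set V) := by
    intro n hn
    induction n, hn using Nat.le_induction with
    | base => exact ⟨hN N le_rfl, rfl⟩
    | succ n hn ih =>
      obtain ⟨h, e⟩ := ih
      refine ⟨hN (n + 1) (by omega), ?_⟩
      rw [← e]
      exact SimpleGraph.ConnectedComponent.eq.2 (SimpleGraph.Adj.reachable (R.adj n).symm)
  exact ⟨⟨N, key⟩, ⟨N, key⟩⟩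

theorem Ray.Equivalent.trans {G : SimpleGraph V} {R₁ R₂ R₃ : Ray G}
    (h : R₁.Equivalent R₂) (h' : R₂.Equivalent R₃) : R₁.Equivalent R₃ := by
  intro T hT
  obtain ⟨C, h₁, N, h₂⟩ := h T hT
  obtain ⟨C', ⟨N', h₂'⟩, h₃⟩ := h' T hT
  obtain ⟨_, e⟩ := h₂ (max N N') (le_max_left _ _)
  obtain ⟨_, e'⟩ := h₂' (max N N') (le_max_right _ _)
  obtain rfl : C = C' := e.symm.trans e'
  exact ⟨C, h₁, h₃⟩

/-- Equivalence of rays. -/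
instance raySetoid (G : SimpleGraph V) : Setoid (Ray G) where
  r := Ray.Equivalent
  iseqv :=
    { refl := Ray.Equivalent.refl
      symm := fun h T hT => let ⟨C, a, b⟩ := h T hT; ⟨C, b, a⟩
      trans := Ray.Equivalent.trans }

/-- The ends of `G`: the equivalence classes of its rays. -/
def Ends (G : SimpleGraph V) : Type u := Quotient (raySetoid G)

/-- `R` is an `ω`-ray, that is, it belongs to the end `ω`. -/
def Ray.BelongsTo {G : SimpleGraph V} (R : Ray G) (ω : Ends G) : Prop :=
  (Quotient.mk (raySetoid G) R : Ends G) = ω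

/-- `(A, B)` is an oriented separation of the induced subgraph `G[Z]`. For `Z = Set.univ` this is
an oriented separation of `G` itself. -/
def IsSeparation (G : SimpleGraph V) (Z A B : Set V) : Prop :=
  A ∪ B = Z ∧ ∀ a ∈ A \ B, ∀ b ∈ B \ A, ¬ G.Adj a b

/-- The oriented separations of `G` of finite order. -/
structure FinSep (G : SimpleGraph V) where
  left : Set V
  right : Set V
  isSeparation : IsSeparation G Set.univ left right
  finite : (left ∩ right).Finite

/-- The set of oriented separations `(A, B)` of finite order with `|A ∩ B| < κ`. -/
def sepsBelow (G : SimpleGraph V) (κ : Cardinal.{u}) : Set (FinSep G) :=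
  {s | Cardinal.mk (s.left ∩ s.right : Set V) < κ}

/-- The set of all `(A, B)` which induce `(A', B')` on `Z`. -/
def basicOpen (G : SimpleGraph V) (Z A' B' : Set V) : Set (FinSep G) :=
  {s | s.left ∩ Z = A' ∧ s.right ∩ Z = B'}

/-- The topology whose basic open sets are the sets of all separations inducing a given separation
of `G[Z]`, for finite sets `Z` of vertices. -/
instance finSepTopology (G : SimpleGraph V) : TopologicalSpace (FinSep G) :=
  TopologicalSpace.generateFrom
    {O | ∃ Z A' B' : Set V, Z.Finite ∧ IsSeparation G Z A' B' ∧ O = basicOpen G Z A' B'}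

/-- The end tangle induced by `ω`: all `(A, B)` of finite order such that every `ω`-ray has a tail
in `B`. -/
def endTangle {G : SimpleGraph V} (ω : Ends G) : Set (FinSep G) :=
  {s | ∀ R : Ray G, R.BelongsTo ω → R.HasTailIn s.right}

/-- The cohesion of `ω`: the supremum of all cardinals `κ ≤ ℵ₁` such that, for all cardinals
`k < κ`, the restriction of the end tangle to the separations of order `< k` is closed. -/
noncomputable def coh {G : SimpleGraph V} (ω : Ends G) : Cardinal.{u} :=
  sSup {κ | κ ≤ Cardinal.aleph 1 ∧ ∀ k < κ, IsClosed (endTangle ω ∩ sepsBelow G k)}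

/-- `ω` has infinite cohesion. -/
def HasInfiniteCohesion {G : SimpleGraph V} (ω : Ends G) : Prop := coh ω = Cardinal.aleph 1

/-- `ω` has unbounded cohesion. -/
def HasUnboundedCohesion {G : SimpleGraph V} (ω : Ends G) : Prop := coh ω = Cardinal.aleph0

/-- `ω` has bounded cohesion `k`. -/
def HasBoundedCohesion {G : SimpleGraph V} (ω : Ends G) (k : ℕ) : Prop := coh ω = k

/-- The (vertex) degree of `ω`: the largest size of a family of pairwise disjoint `ω`-rays. -/
noncomputable def deg {G : SimpleGraph V} (ω : Ends G) : ℕ∞ :=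
  sSup {n | ∃ F : Set (Ray G), (∀ R ∈ F, R.BelongsTo ω) ∧ F.PairwiseDisjoint Ray.verts ∧
    n = F.encard}

/-- The vertex `v` dominates `ω`: there are infinitely many paths, disjoint except at `v`, from `v`
to vertices other than `v` of some ray in `ω`. -/
def Dominates {G : SimpleGraph V} (v : V) (ω : Ends G) : Prop :=
  ∃ R : Ray G, R.BelongsTo ω ∧ ∃ (w : ℕ → V) (P : ∀ i, G.Path v (w i)),
    (∀ i, w i ∈ R.verts \ {v}) ∧
    ∀ i j, i ≠ j → ∀ x, x ∈ (P i).1.support → x ∈ (P j).1.support → x = v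

/-- The number of vertices which dominate `ω`. -/
noncomputable def dom {G : SimpleGraph V} (ω : Ends G) : ℕ∞ := {v : V | Dominates v ω}.encard

end GraphEnd

/-!
Let `D` be the set of vertices dominating `ω`, and let `s` be a separation outside the tangle of
`ω`, so that `ω` lives on its left and `D ⊆ s.left`. If `s` is a limit of separations `s'` in the
tangle, then `D ⊆ s'.right` forces `D ⊆ s.right`, which is impossible for infinite `D`.
Moreover, every `ω`-ray starting outside `s.right` starts outside `s'.right` but ends up inside, so
`r` disjoint `ω`-rays give `r` further vertices in `s'.left ∩ s'.right`, and the order of `s'` is at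
least `r + |D|`.

Conversely, let `D` be finite. Then `(V, D)`, which is not in the tangle, is a limit of
separations `(V \ C, S ∪ D ∪ C)` in the tangle with `|S| ≤ deg ω`. Indeed, a finite set `Y` of
vertices outside `D` is separated from `ω` in `G - D` by some finite set. Choosing `S₁` smallest
with this property, then `S₂` smallest separating `S₁` from `ω`, and so on, Menger's theorem
links all of each `Sᵢ` to `Sᵢ₊₁` by disjoint paths. These concatenate to `|S₁|` disjoint `ω`-rays,
and hence `|S₁| ≤ deg ω`.
-/

namespace GraphEnd

open Filter Topology

variable {V : Type u} {G : SimpleGraph V}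

/-- Disjoint paths inside `W` from all of `B` to `A`, encoded following Ingleton and Piff by one
injective map `f` which fixes each vertex outside `A` or moves it to a neighbour, and which never
enters `B`: for finite `W`, the path from `b ∈ B` is the orbit of `b` up to its first vertex in
`A`. -/
structure IsLinking (G : SimpleGraph V) (B A W : Set V) (f : V → V) : Prop where
  subset : B ⊆ W
  mapsTo : Set.MapsTo f (W \ A) (W \ B)
  injOn : Set.InjOn f (W \ A)
  eq_or_adj : ∀ v ∈ W \ A, f v = v ∨ G.Adj v (f v)

theorem encard_le_encard_closedNeighbors {B A W S : Set V} (hB : B ⊆ W) (hBfin : B.Finite)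
    (hS : S ⊆ W \ A)
    (h : ∀ L R, IsSeparation G W L R → B ⊆ L → A ∩ W ⊆ R → B.encard ≤ (L ∩ R).encard) :
    S.encard ≤ {w ∈ W \ B | ∃ v ∈ S, w = v ∨ G.Adj v w}.encard := by
  set N := {w ∈ W \ B | ∃ v ∈ S, w = v ∨ G.Adj v w}
  have hNB : N ∪ B ⊆ W := Set.union_subset (fun w hw => hw.1.1) hB
  have hSN : S ⊆ N ∪ B := fun v hv =>
    (em (v ∈ B)).elim .inr fun hvB => .inl ⟨⟨(hS hv).1, hvB⟩, v, hv, .inl rfl⟩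
  have hsep : IsSeparation G W (N ∪ B) (W \ S) := by
    refine ⟨(Set.union_subset hNB Set.sdiff_subset).antisymm fun v hv =>
      (em (v ∈ S)).elim (fun h => .inl (hSN h)) fun h => .inr ⟨hv, h⟩, ?_⟩
    rintro a ⟨ha, haS⟩ b ⟨⟨hbW, -⟩, hb⟩ hab
    have haS : a ∈ S := not_not.1 fun h => haS ⟨hNB ha, h⟩
    exact hb (.inl ⟨⟨hbW, fun hbB => hb (.inr hbB)⟩, a, haS, .inr hab⟩)
  have hle : B.encard ≤ ((N ∪ B) \ S).encard :=
    (h _ _ hsep Set.subset_union_right fun v hv => ⟨hv.2, fun hvS => (hS hvS).2 hv.1⟩).trans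
      (Set.encard_le_encard fun v hv => ⟨hv.1, hv.2.2⟩)
  refine (ENat.add_le_add_iff_left (Set.encard_ne_top_iff.2 hBfin)).1 ?_
  calc
    B.encard + S.encard ≤ ((N ∪ B) \ S).encard + S.encard := by gcongr
    _ = (N ∪ B).encard := Set.encard_sdiff_add_encard_of_subset hSN
    _ ≤ B.encard + N.encard := by rw [add_comm]; exact Set.encard_union_le _ _

theorem exists_isLinking_of_finite {B A W : Set V} (hW : W.Finite) (hB : B ⊆ W)
    (h : ∀ L R, IsSeparation G W L R → B ⊆ L → A ∩ W ⊆ R → B.encard ≤ (L ∩ R).encard) :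
    ∃ f, IsLinking G B A W f := by
  classical
  lift W to Finset V using hW
  let t (v : ↥((W : Set V) \ A)) : Finset V := {w ∈ W | w ∉ B ∧ (w = v ∨ G.Adj v w)}
  have hall (S : Finset ↥((W : Set V) \ A)) : S.card ≤ (S.biUnion t).card := by
    have := encard_le_encard_closedNeighbors hB (W.finite_toSet.subset hB)
      (S := Subtype.val '' (S : Set ↥((W : Set V) \ A))) (by rintro _ ⟨v, -, rfl⟩; exact v.2) h
    rw [Subtype.val_injective.encard_image, Set.encard_coe_eq_coe_finsetCard] at this
    rw [← Nat.cast_le (α := ℕ∞), ← Set.encard_coe_eq_coe_finsetCard (S.biUnion t)]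
    refine this.trans (Set.encard_le_encard ?_)
    rintro w ⟨⟨hwW, hwB⟩, _, ⟨v, hv, rfl⟩, hvw⟩
    exact Finset.mem_biUnion.2 ⟨v, hv, Finset.mem_filter.2 ⟨hwW, hwB, hvw⟩⟩
  obtain ⟨f, hf, hft⟩ := (Finset.all_card_le_biUnion_card_iff_exists_injective t).1 hall
  have hft (v) := Finset.mem_filter.1 (hft v)
  have hfe (v) (hv : v ∈ (W : Set V) \ A) : Function.extend Subtype.val f id v = f ⟨v, hv⟩ :=
    Subtype.val_injective.extend_apply f id ⟨v, hv⟩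
  refine ⟨Function.extend Subtype.val f id, hB, fun v hv => ?_, fun v hv w hw hvw => ?_,
    fun v hv => ?_⟩
  · rw [hfe v hv]
    exact ⟨(hft _).1, (hft _).2.1⟩
  · rw [hfe v hv, hfe w hw] at hvw
    exact congrArg Subtype.val (hf hvw)
  · rw [hfe v hv]
    exact (hft ⟨v, hv⟩).2.2

theorem IsSeparation.inter {Z L R : Set V} (h : IsSeparation G Z L R) (F : Set V) :
    IsSeparation G (Z ∩ F) (L ∩ F) (R ∩ F) :=
  ⟨by rw [← Set.union_inter_distrib_right, h.1],
    fun a ha b hb => h.2 a ⟨ha.1.1, fun haR => ha.2 ⟨haR, ha.1.2⟩⟩ b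
      ⟨hb.1.1, fun hbL => hb.2 ⟨hbL, hb.1.2⟩⟩⟩

theorem exists_isSeparation_of_forall_finset {Z A B : Set V} {k : ℕ∞} (hk : k ≠ ⊤)
    (h : ∀ F : Finset V, ∃ L R, IsSeparation G (Z ∩ F) L R ∧ B ∩ F ⊆ L ∧ A ∩ F ⊆ R ∧
      (L ∩ R).encard < k) :
    ∃ L R, IsSeparation G Z L R ∧ B ⊆ L ∧ A ⊆ R ∧ (L ∩ R).encard < k := by
  choose L R hsep hB hA hcard using h
  let 𝒰 : Ultrafilter (Finset V) := .of atTop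
  have hmem (v : V) : ∀ᶠ F : Finset V in 𝒰, v ∈ F :=
    Ultrafilter.of_le _ ((eventually_ge_atTop {v}).mono fun F hF => by simpa using hF)
  let L' : Set V := {v | ∀ᶠ F in 𝒰, v ∈ L F}
  let R' : Set V := {v | ∀ᶠ F in 𝒰, v ∈ R F}
  refine ⟨L', R', ⟨?_, ?_⟩, fun v hv => (hmem v).mono fun F hF => hB F ⟨hv, hF⟩,
    fun v hv => (hmem v).mono fun F hF => hA F ⟨hv, hF⟩, ?_⟩
  · ext v
    have hv : ∀ᶠ F in 𝒰, (v ∈ L F ∨ v ∈ R F ↔ v ∈ Z) := (hmem v).mono fun F hF => by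
      rw [← Set.mem_union, (hsep F).1]
      exact and_iff_left hF
    rw [Set.mem_union, Set.mem_ofPred, Set.mem_ofPred, ← Ultrafilter.eventually_or,
      eventually_congr hv, eventually_const]
  · rintro a ⟨haL, haR⟩ b ⟨hbR, hbL⟩
    obtain ⟨F, ⟨haL, haR⟩, hbR, hbL⟩ := ((Eventually.and haL
      (Ultrafilter.eventually_not.2 haR)).and
      (Eventually.and hbR (Ultrafilter.eventually_not.2 hbL))).exists
    exact (hsep F).2 a ⟨haL, haR⟩ b ⟨hbR, hbL⟩
  · by_contra! hle
    obtain ⟨t, htLR, rfl⟩ := Set.exists_subset_encard_eq hle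
    have ht : ∀ᶠ F in 𝒰, ∀ v ∈ t, v ∈ L F ∩ R F :=
      (eventually_all_finite (Set.encard_ne_top_iff.1 hk)).2 fun v hv =>
        (htLR hv).1.and (htLR hv).2
    obtain ⟨F, hF⟩ := ht.exists
    exact (hcard F).not_ge (Set.encard_le_encard hF)

theorem exists_isLinking {B A Z : Set V} (hBfin : B.Finite) (hB : B ⊆ Z)
    (h : ∀ L R, IsSeparation G Z L R → B ⊆ L → A ∩ Z ⊆ R → B.encard ≤ (L ∩ R).encard) :
    ∃ W ⊆ Z, W.Finite ∧ ∃ f, IsLinking G B A W f := by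
  classical
  by_contra! hno
  suffices ∃ L R, IsSeparation G Z L R ∧ B ⊆ L ∧ A ∩ Z ⊆ R ∧ (L ∩ R).encard < B.encard by
    obtain ⟨L, R, hsep, hBL, hAR, hlt⟩ := this
    exact hlt.not_ge (h L R hsep hBL hAR)
  refine exists_isSeparation_of_forall_finset (Set.encard_ne_top_iff.2 hBfin) fun F => ?_
  have hW : (Z ∩ (F ∪ B)).Finite := (F.finite_toSet.union hBfin).inter_of_right Z
  obtain ⟨L, R, hsep, hBL, hAR, hlt⟩ : ∃ L R, IsSeparation G (Z ∩ (F ∪ B)) L R ∧ B ⊆ L ∧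
      A ∩ (Z ∩ (F ∪ B)) ⊆ R ∧ (L ∩ R).encard < B.encard := by
    by_contra! hF
    obtain ⟨f, hf⟩ :=
      exists_isLinking_of_finite hW (Set.subset_inter hB Set.subset_union_right) hF
    exact hno _ Set.inter_subset_left hW f hf
  refine ⟨L ∩ F, R ∩ F, ?_, Set.inter_subset_inter_left _ hBL,
    fun v hv => ⟨hAR ⟨hv.1.1, hv.1.2, .inl hv.2⟩, hv.2⟩,
    (Set.encard_le_encard
      (Set.inter_subset_inter Set.inter_subset_left Set.inter_subset_left)).trans_lt hlt⟩
  have := hsep.inter F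
  rwa [Set.inter_assoc, Set.union_inter_cancel_left] at this

theorem eq_of_iterate_eq {U B : Set V} {f : V → V} (hB : B ⊆ U) (hf : Set.MapsTo f U (U \ B))
    (hinj : Set.InjOn f U) {b b' : V} (hb : b ∈ B) (hb' : b' ∈ B) {m n : ℕ}
    (h : f^[m] b = f^[n] b') : m = n ∧ b = b' := by
  have hU (v) (hv : v ∈ B) (n) : f^[n] v ∈ U :=
    (hf.mono_right Set.sdiff_subset).iterate n (hB hv)
  have hne (v) (hv : v ∈ B) (n) : f^[n + 1] v ∉ B := by
    rw [Function.iterate_succ_apply']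
    exact (hf (hU v hv n)).2
  induction m generalizing n with
  | zero =>
    cases n with
    | zero => exact ⟨rfl, h⟩
    | succ n => exact absurd (h ▸ hb) (hne b' hb' n)
  | succ m ih =>
    cases n with
    | zero => exact absurd (h ▸ hb') (hne b hb m)
    | succ n =>
      rw [Function.iterate_succ_apply', Function.iterate_succ_apply'] at h
      obtain ⟨rfl, hbb'⟩ := ih (hinj (hU b hb m) (hU b' hb' n) h)
      exact ⟨rfl, hbb'⟩

theorem exists_disjoint_rays_of_mapsTo {U B : Set V} {f : V → V} (hB : B ⊆ U)
    (hf : Set.MapsTo f U (U \ B)) (hinj : Set.InjOn f U)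
    (hadj : ∀ v ∈ U, f v = v ∨ G.Adj v (f v)) :
    ∃ R : B → Ray G, Pairwise (Function.onFun Disjoint fun b => (R b).verts) ∧
      ∀ b, (R b).verts ⊆ U := by
  have hU (b : B) (n) : f^[n] b ∈ U := (hf.mono_right Set.sdiff_subset).iterate n (hB b.2)
  refine ⟨fun b => ⟨fun n => f^[n] b,
    fun m n h => (eq_of_iterate_eq hB hf hinj b.2 b.2 h).1, fun n => ?_⟩, fun b b' hbb' => ?_, ?_⟩
  · rw [Function.iterate_succ_apply']
    refine (hadj _ (hU b n)).resolve_left fun h => ?_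
    rw [← Function.iterate_succ_apply' f] at h
    exact absurd (eq_of_iterate_eq hB hf hinj b.2 b.2 h).1 n.succ_ne_self
  · refine Set.disjoint_left.2 ?_
    rintro _ ⟨m, rfl⟩ ⟨n, h⟩
    exact hbb' (Subtype.ext (eq_of_iterate_eq hB hf hinj b'.2 b.2 h).2.symm)
  · rintro b _ ⟨n, rfl⟩
    exact hU b n

theorem Ray.hasTailIn_iff_eventually {R : Ray G} {B : Set V} :
    R.HasTailIn B ↔ ∀ᶠ n in atTop, R.vert n ∈ B :=
  eventually_atTop.symm

theorem Ray.eventually_notMem (R : Ray G) {T : Set V} (hT : T.Finite) :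
    ∀ᶠ n in atTop, R.vert n ∉ T :=
  Nat.cofinite_eq_atTop ▸ R.injective.tendsto_cofinite.eventually hT.eventually_cofinite_notMem

theorem Ray.HasTailIn.mono {R : Ray G} {A B : Set V} (h : R.HasTailIn A) (hAB : A ⊆ B) :
    R.HasTailIn B :=
  let ⟨N, hN⟩ := h
  ⟨N, fun n hn => hAB (hN n hn)⟩

theorem eq_of_mem_sdiff_succ {A : ℕ → Set V} (hA : Antitone A) {i j : ℕ} {v : V}
    (hi : v ∈ A i \ A (i + 1)) (hj : v ∈ A j \ A (j + 1)) : i = j := by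
  refine le_antisymm ?_ ?_ <;> refine not_lt.1 fun h => ?_
  exacts [hj.2 (hA h hi.1), hi.2 (hA h hj.1)]

theorem exists_forall_eqOn {ι α β : Type*} {U : ι → Set α}
    (hU : ∀ i j x, x ∈ U i → x ∈ U j → i = j) (F : ι → α → β) (f₀ : α → β) :
    ∃ f : α → β, ∀ i, Set.EqOn f (F i) (U i) := by
  have (x : α) : ∃ y, ∀ i, x ∈ U i → y = F i x := by
    by_cases h : ∃ i, x ∈ U i
    · obtain ⟨i, hi⟩ := h
      exact ⟨F i x, fun j hj => by rw [hU i j x hi hj]⟩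
    · exact ⟨f₀ x, fun i hi => absurd ⟨i, hi⟩ h⟩
  choose f hf using this
  exact ⟨f, fun i x => hf x i⟩

theorem IsLinking.mem_or_mem {B A W : Set V} {f : V → V} (h : IsLinking G B A W f) {B' : Set V}
    (hadj : ∀ u ∈ W \ A, ∀ v ∈ A, G.Adj u v → v ∈ B') {v : V} (hv : v ∈ W \ A) :
    f v ∈ W \ A ∨ f v ∈ B' := by
  by_cases hA : f v ∈ A
  · refine .inr (hadj v hv _ hA ((h.eq_or_adj v hv).resolve_left fun heq => ?_))
    exact hv.2 (heq ▸ hA)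
  · exact .inl ⟨(h.mapsTo hv).1, hA⟩

theorem exists_disjoint_rays_of_isLinking {K S W : ℕ → Set V} {F : ℕ → V → V}
    (hK : ∀ i, K (i + 1) ⊆ K i \ S i)
    (hadj : ∀ i, ∀ u ∈ K i \ K (i + 1), ∀ v ∈ K (i + 1), G.Adj u v → v ∈ S (i + 1))
    (hWK : ∀ i, W i ⊆ K i) (hWfin : ∀ i, (W i).Finite)
    (hF : ∀ i, IsLinking G (S i) (K (i + 1)) (W i) (F i)) :
    ∃ R : S 0 → Ray G, Pairwise (Function.onFun Disjoint fun s => (R s).verts) ∧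
      ∀ s i, (R s).HasTailIn (K i) := by
  let U (i : ℕ) : Set V := W i \ K (i + 1)
  let C (i : ℕ) : Set V := K i \ S i
  have hKanti : Antitone K := antitone_nat_of_succ_le fun i => (hK i).trans Set.sdiff_subset
  have hCanti : Antitone C := antitone_nat_of_succ_le fun i => Set.sdiff_subset.trans (hK i)
  have hSU (i) : S i ⊆ U i := fun v hv => ⟨(hF i).subset hv, fun h => (hK i h).2 hv⟩
  have hUK (i) : U i ⊆ K i \ K (i + 1) := Set.sdiff_subset_sdiff_left (hWK i)
  have hFU (i v) (hv : v ∈ U i) : F i v ∈ U i ∨ F i v ∈ S (i + 1) :=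
    (hF i).mem_or_mem (fun u hu => hadj i u (hUK i hu)) hv
  have hFC (i v) (hv : v ∈ U i) : F i v ∈ C i \ C (i + 1) :=
    ⟨⟨hWK i ((hF i).mapsTo hv).1, ((hF i).mapsTo hv).2⟩,
      fun h => (hFU i v hv).elim (fun h' => h'.2 h.1) h.2⟩
  obtain ⟨f, hf⟩ := exists_forall_eqOn
    (fun i j v hi hj => eq_of_mem_sdiff_succ hKanti (hUK i hi) (hUK j hj)) F id
  have hmaps : Set.MapsTo f (⋃ i, U i) ((⋃ i, U i) \ S 0) := fun v hv => by
    obtain ⟨i, hi⟩ := Set.mem_iUnion.1 hv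
    rw [hf i hi]
    exact ⟨Set.mem_iUnion.2 ((hFU i v hi).elim (⟨i, ·⟩) fun h => ⟨i + 1, hSU _ h⟩),
      (hCanti i.zero_le (hFC i v hi).1).2⟩
  have hinj : Set.InjOn f (⋃ i, U i) := fun v hv w hw hvw => by
    obtain ⟨i, hi⟩ := Set.mem_iUnion.1 hv
    obtain ⟨j, hj⟩ := Set.mem_iUnion.1 hw
    rw [hf i hi, hf j hj] at hvw
    have hij : i = j := eq_of_mem_sdiff_succ hCanti (hFC i v hi) (hvw ▸ hFC j w hj)
    subst hij
    exact (hF i).injOn hi hj hvw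
  have hstep : ∀ v ∈ ⋃ i, U i, f v = v ∨ G.Adj v (f v) := fun v hv => by
    obtain ⟨i, hi⟩ := Set.mem_iUnion.1 hv
    rw [hf i hi]
    exact (hF i).eq_or_adj v hi
  obtain ⟨R, hdisj, hRU⟩ :=
    exists_disjoint_rays_of_mapsTo ((hSU 0).trans (Set.subset_iUnion U 0)) hmaps hinj hstep
  refine ⟨R, hdisj, fun s i => Ray.hasTailIn_iff_eventually.2 ?_⟩
  have hfin : (⋃ j < i, U j).Finite :=
    (Set.finite_lt_nat i).biUnion fun j _ => (hWfin j).sdiff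
  filter_upwards [(R s).eventually_notMem hfin] with n hn
  obtain ⟨j, hj⟩ := Set.mem_iUnion.1 (hRU s ⟨n, rfl⟩)
  exact hKanti (not_lt.1 fun h => hn (Set.mem_biUnion h hj)) (hUK j hj).1

theorem Ends.exists_belongsTo (ω : Ends G) : ∃ R : Ray G, R.BelongsTo ω :=
  Quotient.exists_rep ω

theorem belongsTo_iff_of_belongsTo {ω : Ends G} {R : Ray G} (hR : R.BelongsTo ω) {R' : Ray G} :
    R'.BelongsTo ω ↔ R.Equivalent R' := by
  subst hR
  exact ⟨fun h => (raySetoid G).symm (Quotient.exact h),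
    fun h => Quotient.sound ((raySetoid G).symm h)⟩

theorem exists_walk_of_mem_componentCompl {T : Set V} {C : G.ComponentCompl T} {u v : V}
    (hu : u ∈ C) (hv : v ∈ C) : ∃ p : G.Walk u v, ∀ x ∈ p.support, x ∉ T := by
  obtain ⟨hu', rfl⟩ := hu
  obtain ⟨hv', huv⟩ := hv
  obtain ⟨p⟩ := SimpleGraph.ConnectedComponent.eq.1 huv.symm
  refine ⟨p.map (SimpleGraph.Embedding.induce (G := G) Tᶜ).toHom, fun x hx => ?_⟩
  replace hx := (SimpleGraph.Walk.support_map _ p) ▸ hx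
  obtain ⟨y, -, rfl⟩ := List.mem_map.1 hx
  exact y.2

/-- The component of `G - T` in which every `ω`-ray has a tail, for finite `T`. For infinite `T`
there need not be such a component, and then this set is empty. -/
def endComponent (ω : Ends G) (T : Set V) : Set V :=
  {v | ∃ C : G.ComponentCompl T, (∀ R : Ray G, R.BelongsTo ω → R.HasTailIn C) ∧ v ∈ C}

variable {ω : Ends G} {S T : Set V} {u v : V}

theorem notMem_of_mem_endComponent (hv : v ∈ endComponent ω T) : v ∉ T :=
  let ⟨_, _, hvC⟩ := hv
  SimpleGraph.ComponentCompl.notMem_of_mem hvC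

theorem mem_endComponent_of_adj (hu : u ∈ endComponent ω T) (hv : v ∉ T) (huv : G.Adj u v) :
    v ∈ endComponent ω T :=
  let ⟨C, hC, huC⟩ := hu
  ⟨C, hC, SimpleGraph.ComponentCompl.mem_of_adj u v huC hv huv⟩

theorem Ray.HasTailIn.inter_nonempty {R : Ray G} {A B : Set V} (hA : R.HasTailIn A)
    (hB : R.HasTailIn B) : (A ∩ B).Nonempty :=
  let ⟨n, hn⟩ := ((hasTailIn_iff_eventually.1 hA).and (hasTailIn_iff_eventually.1 hB)).exists
  ⟨R.vert n, hn⟩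

theorem exists_walk_of_mem_endComponent (hu : u ∈ endComponent ω T) (hv : v ∈ endComponent ω T) :
    ∃ p : G.Walk u v, ∀ x ∈ p.support, x ∉ T := by
  obtain ⟨C, hC, hu⟩ := hu
  obtain ⟨C', hC', hv⟩ := hv
  obtain ⟨R, hR⟩ := ω.exists_belongsTo
  obtain ⟨w, ⟨_, rfl⟩, ⟨_, rfl⟩⟩ := (hC R hR).inter_nonempty (hC' R hR)
  exact exists_walk_of_mem_componentCompl hu hv

theorem mem_endComponent_of_walk (p : G.Walk u v) (hp : ∀ x ∈ p.support, x ∉ T)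
    (hu : u ∈ endComponent ω T) : v ∈ endComponent ω T := by
  by_contra hv
  obtain ⟨d, hd, hfst, hsnd⟩ := p.exists_boundary_dart _ hu hv
  exact hsnd (mem_endComponent_of_adj hfst (hp _ (p.dart_snd_mem_support_of_mem_darts hd)) d.adj)

theorem endComponent_subset_of_forall_adj {P : Set V} (h : (endComponent ω T ∩ P).Nonempty)
    (hP : ∀ x ∈ endComponent ω T, x ∈ P → ∀ y ∈ endComponent ω T, G.Adj x y → y ∈ P) :
    endComponent ω T ⊆ P := by
  obtain ⟨u, hu, huP⟩ := h
  intro v hv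
  by_contra hvP
  obtain ⟨p, hp⟩ := exists_walk_of_mem_endComponent hu hv
  obtain ⟨d, hd, hfst, hsnd⟩ :=
    p.exists_boundary_dart (endComponent ω T ∩ P) ⟨hu, huP⟩ fun h => hvP h.2
  have hmem := mem_endComponent_of_adj hfst.1 (hp _ (p.dart_snd_mem_support_of_mem_darts hd)) d.adj
  exact hsnd ⟨hmem, hP _ hfst.1 hfst.2 _ hmem d.adj⟩

theorem exists_componentCompl (ω : Ends G) (hT : T.Finite) :
    ∃ C : G.ComponentCompl T, ∀ R : Ray G, R.BelongsTo ω → R.HasTailIn C := by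
  obtain ⟨R, hR⟩ := ω.exists_belongsTo
  obtain ⟨C, hC, -⟩ := Ray.Equivalent.refl R T hT
  refine ⟨C, fun R' hR' => ?_⟩
  obtain ⟨C', hC', hR'C'⟩ := (belongsTo_iff_of_belongsTo hR).1 hR' T hT
  obtain ⟨w, ⟨_, rfl⟩, ⟨_, rfl⟩⟩ := hC.inter_nonempty hC'
  exact hR'C'

theorem Ray.BelongsTo.hasTailIn_endComponent {R : Ray G} (hR : R.BelongsTo ω) (hT : T.Finite) :
    R.HasTailIn (endComponent ω T) :=
  let ⟨C, hC⟩ := exists_componentCompl ω hT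
  (hC R hR).mono fun _ hv => ⟨C, hC, hv⟩

theorem endComponent_inter_nonempty (hS : S.Finite) (hT : T.Finite) :
    (endComponent ω S ∩ endComponent ω T).Nonempty :=
  let ⟨_, hR⟩ := ω.exists_belongsTo
  (hR.hasTailIn_endComponent hS).inter_nonempty (hR.hasTailIn_endComponent hT)

theorem endComponent_subset_endComponent (hS : S.Finite) (hT : T.Finite)
    (h : Disjoint T (endComponent ω S)) : endComponent ω S ⊆ endComponent ω T :=
  endComponent_subset_of_forall_adj (endComponent_inter_nonempty hS hT) fun _ _ hx _ hy hxy =>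
    mem_endComponent_of_adj hx (Set.disjoint_right.1 h hy) hxy

theorem endComponent_anti (hT : T.Finite) (hST : S ⊆ T) :
    endComponent ω T ⊆ endComponent ω S :=
  endComponent_subset_endComponent hT (hT.subset hST)
    (Set.disjoint_left.2 fun _ hv hv' => notMem_of_mem_endComponent hv' (hST hv))

theorem belongsTo_of_forall_hasTailIn {R : Ray G}
    (h : ∀ T : Set V, T.Finite → R.HasTailIn (endComponent ω T)) : R.BelongsTo ω := by
  obtain ⟨R₀, hR₀⟩ := ω.exists_belongsTo
  refine (belongsTo_iff_of_belongsTo hR₀).2 fun T hT => ?_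
  obtain ⟨C, hC⟩ := exists_componentCompl ω hT
  refine ⟨C, hC R₀ hR₀, (h T hT).mono ?_⟩
  rintro v ⟨C', hC', hv⟩
  obtain ⟨w, ⟨_, rfl⟩, ⟨_, rfl⟩⟩ := (hC R₀ hR₀).inter_nonempty (hC' R₀ hR₀)
  exact hv

theorem Dominates.mem_endComponent (h : Dominates v ω) (hT : T.Finite) (hv : v ∉ T) :
    v ∈ endComponent ω T := by
  obtain ⟨R, hR, w, P, hw, hP⟩ := h
  have hwT : ∃ i, (∀ x ∈ (P i).1.support, x ∉ T) ∧ w i ∈ endComponent ω T := by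
    obtain ⟨N, hN⟩ := hR.hasTailIn_endComponent hT
    by_contra! hno
    have hbad (i) : ∃ x ∈ (P i).1.support, x ∈ T ∪ R.vert '' Set.Iio N \ {v} := by
      by_contra! h
      have hiT : ∀ x ∈ (P i).1.support, x ∉ T := fun x hx hxT => h x hx (.inl hxT)
      obtain ⟨⟨n, hn⟩, hwv⟩ := hw i
      refine hno i hiT (hn ▸ hN n (not_lt.1 fun hlt => ?_))
      exact h _ (P i).1.end_mem_support (.inr ⟨⟨n, hlt, hn⟩, hwv⟩)
    choose x hxP hx using hbad
    have hfin : (T ∪ R.vert '' Set.Iio N \ {v}).Finite :=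
      hT.union ((Set.finite_Iio N).image _).sdiff
    obtain ⟨i, -, j, -, hij, hxij⟩ :=
      Set.infinite_univ.exists_ne_map_eq_of_mapsTo (fun i _ => hx i) hfin
    have hxv := hP i j hij _ (hxP i) (hxij ▸ hxP j)
    exact (hx i).elim (fun hxT => hv (hxv ▸ hxT)) fun h => h.2 hxv
  obtain ⟨i, hi, hwi⟩ := hwT
  exact mem_endComponent_of_walk (P i).1.reverse (by simpa using hi) hwi

theorem dominates_of_forall_mem_endComponent
    (h : ∀ T : Set V, T.Finite → v ∉ T → v ∈ endComponent ω T) : Dominates v ω := by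
  classical
  obtain ⟨R, hR⟩ := ω.exists_belongsTo
  have : Std.Symm fun p q : Σ w, G.Path v w =>
      ∀ x, x ∈ p.2.1.support → x ∈ q.2.1.support → x = v := ⟨fun _ _ h x hx hx' => h x hx' hx⟩
  have hnext (s : Finset (Σ w, G.Path v w)) : ∃ p : Σ w, G.Path v w, p.1 ∈ R.verts \ {v} ∧
      ∀ q ∈ s, ∀ x, x ∈ q.2.1.support → x ∈ p.2.1.support → x = v := by
    let T : Set V := (⋃ q ∈ s, {x | x ∈ q.2.1.support}) \ {v}
    have hT : T.Finite := (s.finite_toSet.biUnion fun q _ => q.2.1.support.finite_toSet).sdiff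
    obtain ⟨n, hn, hnv⟩ := ((Ray.hasTailIn_iff_eventually.1 (hR.hasTailIn_endComponent hT)).and
      (R.eventually_notMem (Set.finite_singleton v))).exists
    obtain ⟨p, hp⟩ := exists_walk_of_mem_endComponent (h T hT fun hv => hv.2 rfl) hn
    refine ⟨⟨R.vert n, p.toPath⟩, ⟨⟨n, rfl⟩, hnv⟩, fun q hq x hxq hxp => ?_⟩
    by_contra hxv
    exact hp x (p.support_toPath_subset_support hxp) ⟨Set.mem_biUnion hq hxq, hxv⟩
  obtain ⟨p, hp, hpp⟩ := exists_seq_of_forall_finset_exists' _ _ fun s _ => hnext s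
  exact ⟨R, hR, fun i => (p i).1, fun i => (p i).2, hp, fun i j hij => hpp hij⟩

/-- The finite set `S` separates `Y` from the end `ω` in `G - D`, on the side of `Y` where `ω`
lives; in particular `S` is disjoint from `Y`. -/
structure Separates (ω : Ends G) (D Y S : Set V) : Prop where
  finite : S.Finite
  subset : S ⊆ endComponent ω (Y ∪ D)
  disjoint : Disjoint Y (endComponent ω (S ∪ D))

/-- The part of `G - D` cut off by a separator `S` on the side of `ω`, including `S` itself. -/
def endSide (ω : Ends G) (D S : Set V) : Set V := S ∪ endComponent ω (S ∪ D)

variable {D Y S' : Set V}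

theorem Separates.endComponent_subset (h : Separates ω D Y S) (hD : D.Finite) (hY : Y.Finite) :
    endComponent ω (S ∪ D) ⊆ endComponent ω (Y ∪ D) :=
  endComponent_subset_endComponent (h.finite.union hD) (hY.union hD)
    (Set.disjoint_union_left.2 ⟨h.disjoint, Set.disjoint_left.2 fun _ hv hv' =>
      notMem_of_mem_endComponent hv' (.inr hv)⟩)

theorem Separates.endSide_subset (h : Separates ω D Y S) (hD : D.Finite) (hY : Y.Finite) :
    endSide ω D S ⊆ endComponent ω (Y ∪ D) :=
  Set.union_subset h.subset (h.endComponent_subset hD hY)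

theorem mem_of_adj_of_notMem_endSide (huD : u ∉ D) (hu : u ∉ endSide ω D S)
    (hv : v ∈ endSide ω D S) (huv : G.Adj u v) : v ∈ S :=
  hv.resolve_right fun hv => hu <| .inr <|
    mem_endComponent_of_adj hv (fun h => h.elim (fun h => hu (.inl h)) huD) huv.symm

theorem exists_separates (hD : D.Finite) (hY : Y.Finite) (h : ∀ y ∈ Y, ¬ Dominates y ω) :
    ∃ S, Separates ω D Y S := by
  have hT (y : V) : ∃ T : Set V, T.Finite ∧ (y ∈ Y → y ∉ T ∧ y ∉ endComponent ω T) := by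
    by_contra! hno
    exact h y (hno ∅ Set.finite_empty).1
      (dominates_of_forall_mem_endComponent fun T hT => (hno T hT).2)
  choose T hTfin hT using hT
  let T' : Set V := ⋃ y ∈ Y, T y
  have hT'fin : T'.Finite := hY.biUnion fun y _ => hTfin y
  have hfin : (Y ∪ T' ∪ D).Finite := (hY.union hT'fin).union hD
  have hSfin : (T' ∩ endComponent ω (Y ∪ D)).Finite := hT'fin.inter_of_left _
  suffices hsub : endComponent ω (T' ∩ endComponent ω (Y ∪ D) ∪ D) ⊆
      endComponent ω (Y ∪ T' ∪ D) from
    ⟨_, hSfin, Set.inter_subset_right, Set.disjoint_left.2 fun y hy hy' =>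
      notMem_of_mem_endComponent (hsub hy') (.inl (.inl hy))⟩
  refine endComponent_subset_of_forall_adj (endComponent_inter_nonempty (hSfin.union hD) hfin)
    fun u _ hu v hv huv => mem_endComponent_of_adj hu ?_ huv
  have hvS := notMem_of_mem_endComponent hv
  have hvY : v ∉ Y := fun hvY =>
    (hT v hvY).2 <| mem_endComponent_of_adj (endComponent_anti hfin
      (fun x hx => .inl (.inr (Set.mem_biUnion hvY hx))) hu) (hT v hvY).1 huv
  rintro ((hvY' | hvT) | hvD)
  · exact hvY hvY'
  · have hu' := endComponent_anti hfin
      (Set.union_subset_union_left D Set.subset_union_left) hu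
    have hvYD : v ∉ Y ∪ D := fun h => h.elim hvY fun h => hvS (.inr h)
    exact hvS (.inl ⟨hvT, mem_endComponent_of_adj hu' hvYD huv⟩)
  · exact hvS (.inr hvD)

theorem Separates.inter_of_isSeparation (hS : Separates ω D Y S) (hS' : Separates ω D S S')
    (hD : D.Finite) (hY : Y.Finite) {L R : Set V} (hLR : IsSeparation G (endSide ω D S) L R)
    (hL : S ⊆ L) (hR : endSide ω D S' ⊆ R) (hfin : (L ∩ R).Finite) :
    Separates ω D Y (L ∩ R) := by
  have hsub := hS.endSide_subset hD hY
  suffices h : endComponent ω (L ∩ R ∪ D) ⊆ R \ L from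
    ⟨hfin, fun v hv => hsub (hLR.1 ▸ .inl hv.1), Set.disjoint_left.2 fun y hy hy' =>
      notMem_of_mem_endComponent (hsub (hLR.1 ▸ .inr (h hy').1)) (.inl hy)⟩
  obtain ⟨w, hw, hw'⟩ := endComponent_inter_nonempty (ω := ω) (hfin.union hD) (hS'.finite.union hD)
  have hwR : w ∈ R := hR (.inr hw')
  refine endComponent_subset_of_forall_adj
    ⟨w, hw, hwR, fun hwL => notMem_of_mem_endComponent hw (.inl ⟨hwL, hwR⟩)⟩ ?_
  rintro u - ⟨huR, huL⟩ v hv huv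
  have hvX := notMem_of_mem_endComponent hv
  have hvL : v ∉ L := fun hvL =>
    hLR.2 v ⟨hvL, fun hvR => hvX (.inl ⟨hvL, hvR⟩)⟩ u ⟨huR, huL⟩ huv.symm
  have hu : u ∈ endComponent ω (S ∪ D) :=
    (hLR.1 ▸ Set.mem_union_right L huR : u ∈ endSide ω D S).resolve_left fun h => huL (hL h)
  have hvSide : v ∈ endSide ω D S := .inr <| mem_endComponent_of_adj hu
    (fun h => h.elim (fun h => hvL (hL h)) fun h => hvX (.inr h)) huv
  exact ⟨(hLR.1.symm ▸ hvSide : v ∈ L ∪ R).resolve_left hvL, hvL⟩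

theorem exists_isLinking_of_minimalFor (hD : D.Finite) (hY : Y.Finite)
    (hS : MinimalFor (Separates ω D Y) Set.encard S) (hS' : Separates ω D S S') :
    ∃ W ⊆ endSide ω D S, W.Finite ∧ ∃ f, IsLinking G S (endSide ω D S') W f := by
  refine exists_isLinking hS.1.finite Set.subset_union_left fun L R hLR hL hR => ?_
  have hsub : endSide ω D S' ⊆ endSide ω D S :=
    (hS'.endSide_subset hD hS.1.finite).trans Set.subset_union_right
  rw [Set.inter_eq_left.2 hsub] at hR
  by_cases hfin : (L ∩ R).Finite
  · exact not_lt.1 fun hlt => hlt.not_ge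
      (hS.2 (hS.1.inter_of_isSeparation hS' hD hY hLR hL hR hfin) hlt.le)
  · rw [Set.encard_eq_top_iff.2 hfin]
    exact le_top

theorem exists_notMem_endComponent {T : ℕ → Set V} (hD : D.Finite) (hT : ∀ i, (T i).Finite)
    (h : ∀ i, Separates ω D (T i) (T (i + 1))) (hne : (T 1).Nonempty) (v : V) :
    ∃ i, v ∉ endComponent ω (T i ∪ D) := by
  by_contra! hv
  suffices hsub : endComponent ω (T 0 ∪ D) ⊆ ⋂ i, endComponent ω (T i ∪ D) by
    obtain ⟨t, ht⟩ := hne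
    exact notMem_of_mem_endComponent (Set.mem_iInter.1 (hsub ((h 0).subset ht)) 1) (.inl ht)
  refine endComponent_subset_of_forall_adj ⟨v, hv 0, Set.mem_iInter.2 hv⟩ ?_
  refine fun x _ hx y hy hxy => Set.mem_iInter.2 fun i => ?_
  have hyD : y ∉ D := fun hyD => notMem_of_mem_endComponent hy (.inr hyD)
  by_cases hyT : y ∈ T (i + 1)
  · exact (h i).subset hyT
  · exact (h i).endComponent_subset hD (hT i) <| mem_endComponent_of_adj
      (Set.mem_iInter.1 hx (i + 1)) (fun h => h.elim hyT hyD) hxy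

theorem card_le_deg {ι : Type*} {R : ι → Ray G} (hR : ∀ i, (R i).BelongsTo ω)
    (hdisj : Pairwise (Function.onFun Disjoint fun i => (R i).verts)) : ENat.card ι ≤ deg ω := by
  have hinj : Function.Injective R := fun i j hij => by
    by_contra hne
    exact Set.disjoint_left.1 (hdisj hne) ⟨0, rfl⟩ ⟨0, by rw [hij]⟩
  refine hinj.encard_range.trans (le_sSup ⟨Set.range R, by rintro _ ⟨i, rfl⟩; exact hR i, ?_, rfl⟩)
  rintro _ ⟨i, rfl⟩ _ ⟨j, rfl⟩ hij
  exact hdisj fun h => hij (congrArg R h)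

theorem exists_seq_minimalFor_separates (hD : D.Finite) (hdom : ∀ v ∉ D, ¬ Dominates v ω)
    (hY : Y.Finite) (hYD : Disjoint Y D) :
    ∃ T : ℕ → Set V, T 0 = Y ∧ (∀ i, (T i).Finite) ∧
      ∀ i, MinimalFor (Separates ω D (T i)) Set.encard (T (i + 1)) := by
  have hnext (Z : Set V) : ∃ S : Set V, Z.Finite → Disjoint Z D →
      MinimalFor (Separates ω D Z) Set.encard S := by
    by_cases hZ : Z.Finite ∧ Disjoint Z D
    · obtain ⟨S, hS⟩ := exists_minimalFor_of_wellFoundedLT _ Set.encard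
        (exists_separates hD hZ.1 fun y hy => hdom y (Set.disjoint_left.1 hZ.2 hy))
      exact ⟨S, fun _ _ => hS⟩
    · exact ⟨∅, fun h h' => absurd ⟨h, h'⟩ hZ⟩
  choose next hnext using hnext
  have hgood (i : ℕ) : (next^[i] Y).Finite ∧ Disjoint (next^[i] Y) D := by
    induction i with
    | zero => exact ⟨hY, hYD⟩
    | succ i ih =>
      rw [Function.iterate_succ_apply']
      have hS := (hnext _ ih.1 ih.2).1
      exact ⟨hS.finite, Set.disjoint_left.2 fun v hv hvD =>
        notMem_of_mem_endComponent (hS.subset hv) (.inr hvD)⟩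
  refine ⟨fun i => next^[i] Y, rfl, fun i => (hgood i).1, fun i => ?_⟩
  simp only [Function.iterate_succ_apply']
  exact hnext _ (hgood i).1 (hgood i).2

theorem exists_separates_encard_le_deg (hD : D.Finite) (hdom : ∀ v ∉ D, ¬ Dominates v ω)
    (hY : Y.Finite) (hYD : Disjoint Y D) : ∃ S, Separates ω D Y S ∧ S.encard ≤ deg ω := by
  obtain ⟨T, rfl, hTfin, hT⟩ := exists_seq_minimalFor_separates hD hdom hY hYD
  have hsep (i) : Separates ω D (T i) (T (i + 1)) := (hT i).1
  refine ⟨T 1, hsep 0, ?_⟩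
  have hside (i) := (hsep i).endSide_subset hD (hTfin i)
  choose W hWK hWfin F hF using fun i =>
    exists_isLinking_of_minimalFor hD (hTfin i) (hT i) (hsep (i + 1))
  obtain ⟨R, hdisj, hR⟩ := exists_disjoint_rays_of_isLinking (K := fun i => endSide ω D (T (i + 1)))
    (fun i v hv => ⟨.inr (hside (i + 1) hv), fun h =>
      notMem_of_mem_endComponent (hside (i + 1) hv) (.inl h)⟩)
    (fun i u hu v hv => mem_of_adj_of_notMem_endSide
      (fun h => notMem_of_mem_endComponent (hside i hu.1) (.inr h)) hu.2 hv) hWK hWfin hF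
  refine card_le_deg (fun s => belongsTo_of_forall_hasTailIn fun X hX => ?_) hdisj
  have hanti : Antitone fun i => endComponent ω (T i ∪ D) :=
    antitone_nat_of_succ_le fun i => (hsep i).endComponent_subset hD (hTfin i)
  have hX' : ∀ᶠ i in atTop, ∀ v ∈ X, v ∉ endComponent ω (T i ∪ D) :=
    (eventually_all_finite hX).2 fun v _ =>
      let ⟨i, hi⟩ := exists_notMem_endComponent hD hTfin hsep ⟨s, s.2⟩ v
      (eventually_ge_atTop i).mono fun j hij hv => hi (hanti hij hv)
  obtain ⟨i, hi⟩ := hX'.exists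
  exact (hR s i).mono ((hside i).trans (endComponent_subset_endComponent ((hTfin i).union hD) hX
    (Set.disjoint_left.2 hi)))

theorem FinSep.mem_or_mem (s : FinSep G) (v : V) : v ∈ s.left ∨ v ∈ s.right :=
  s.isSeparation.1.symm.subset (Set.mem_univ v)

theorem FinSep.mem_right_of_adj (s : FinSep G) (hu : u ∉ s.left) (huv : G.Adj u v) :
    v ∈ s.right := by
  by_contra hv
  exact s.isSeparation.2 v ⟨(s.mem_or_mem v).resolve_right hv, hv⟩ u
    ⟨(s.mem_or_mem u).resolve_left hu, hu⟩ huv.symm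

theorem FinSep.endComponent_subset_right {s : FinSep G}
    (h : (endComponent ω (s.left ∩ s.right) ∩ s.right).Nonempty) :
    endComponent ω (s.left ∩ s.right) ⊆ s.right :=
  endComponent_subset_of_forall_adj h fun _ hx hxr _ _ hxy =>
    s.mem_right_of_adj (fun hxl => notMem_of_mem_endComponent hx ⟨hxl, hxr⟩) hxy

theorem mem_endTangle_iff {s : FinSep G} :
    s ∈ endTangle ω ↔ (endComponent ω (s.left ∩ s.right) ∩ s.right).Nonempty := by
  refine ⟨fun h => ?_, fun h R hR => (hR.hasTailIn_endComponent s.finite).mono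
    (FinSep.endComponent_subset_right h)⟩
  obtain ⟨R, hR⟩ := ω.exists_belongsTo
  exact (hR.hasTailIn_endComponent s.finite).inter_nonempty (h R hR)

theorem Ray.BelongsTo.eventually_notMem_right {R : Ray G} (hR : R.BelongsTo ω) {s : FinSep G}
    (hs : s ∉ endTangle ω) : ∀ᶠ n in atTop, R.vert n ∉ s.right :=
  (hasTailIn_iff_eventually.1 (hR.hasTailIn_endComponent s.finite)).mono fun _ hn hnr =>
    hs (mem_endTangle_iff.2 ⟨_, hn, hnr⟩)

theorem Dominates.mem_right (hv : Dominates v ω) {s : FinSep G} (hs : s ∈ endTangle ω) :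
    v ∈ s.right := by
  by_contra hvr
  exact hvr (FinSep.endComponent_subset_right (mem_endTangle_iff.1 hs)
    (hv.mem_endComponent s.finite fun h => hvr h.2))

theorem Dominates.mem_left (hv : Dominates v ω) {s : FinSep G} (hs : s ∉ endTangle ω) :
    v ∈ s.left := by
  by_contra hvl
  exact hs (mem_endTangle_iff.2 ⟨v, hv.mem_endComponent s.finite fun h => hvl h.1,
    (s.mem_or_mem v).resolve_left hvl⟩)

/-- The separation of `G` along the finite set `T` whose right side consists of `T` and the
component of `G - T` in which `ω` lives. -/
def endSep (ω : Ends G) (hT : T.Finite) : FinSep G where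
  left := (endComponent ω T)ᶜ
  right := T ∪ endComponent ω T
  isSeparation := by
    refine ⟨Set.eq_univ_of_forall fun v => ?_, ?_⟩
    · by_cases hv : v ∈ endComponent ω T
      exacts [.inr (.inr hv), .inl hv]
    · rintro a ⟨ha, ha'⟩ b ⟨-, hb⟩ hab
      exact ha (mem_endComponent_of_adj (not_not.1 hb) (fun h => ha' (.inl h)) hab.symm)
  finite := hT.subset fun _ hv => hv.2.resolve_right hv.1

theorem endSep_left_inter_right (hT : T.Finite) :
    (endSep ω hT).left ∩ (endSep ω hT).right = T :=
  Set.Subset.antisymm (fun _ hv => hv.2.resolve_right hv.1)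
    fun _ hv => ⟨fun h => notMem_of_mem_endComponent h hv, .inl hv⟩

theorem endSep_mem_endTangle (hT : T.Finite) : endSep ω hT ∈ endTangle ω :=
  fun _ hR => (hR.hasTailIn_endComponent hT).mono Set.subset_union_right

theorem exists_mem_endTangle_of_finite (hdom : {v | Dominates v ω}.Finite) {Z : Set V}
    (hZ : Z.Finite) :
    ∃ s ∈ endTangle ω, Z ⊆ s.left ∧ s.right ∩ Z = {v | Dominates v ω} ∩ Z ∧
      (s.left ∩ s.right).encard ≤ deg ω + dom ω := by
  let D : Set V := {v | Dominates v ω}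
  obtain ⟨S, hS, hSdeg⟩ := exists_separates_encard_le_deg hdom (fun _ hv => hv)
    (hZ.sdiff (t := D)) Set.disjoint_sdiff_left
  have hZC : ∀ z ∈ Z, z ∉ endComponent ω (S ∪ D) := fun z hz hzC =>
    Set.disjoint_left.1 hS.disjoint ⟨hz, fun h => notMem_of_mem_endComponent hzC (.inr h)⟩ hzC
  have hSZ : ∀ z ∈ S, z ∉ Z := fun z hzS hz =>
    notMem_of_mem_endComponent (hS.subset hzS) (by rw [Set.sdiff_union_self]; exact .inl hz)
  refine ⟨endSep ω (hS.finite.union hdom), endSep_mem_endTangle _, hZC, ?_, ?_⟩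
  · ext z
    refine and_congr_left fun hz => ⟨?_, fun h => .inl (.inr h)⟩
    rintro ((hzS | hzD) | hzC)
    exacts [absurd hz (hSZ z hzS), hzD, absurd hzC (hZC z hz)]
  · rw [endSep_left_inter_right]
    exact (Set.encard_union_le _ _).trans (add_le_add_left hSdeg _)

theorem FinSep.isSeparation_inter (s : FinSep G) (Z : Set V) :
    IsSeparation G Z (s.left ∩ Z) (s.right ∩ Z) := by
  simpa only [Set.univ_inter] using s.isSeparation.inter Z

theorem basicOpen_inter_subset {Z Z' : Set V} (h : Z ⊆ Z') (A B : Set V) :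
    basicOpen G Z' (A ∩ Z') (B ∩ Z') ⊆ basicOpen G Z (A ∩ Z) (B ∩ Z) := by
  rintro s ⟨hl, hr⟩
  rw [← Set.inter_eq_right.2 h, ← Set.inter_assoc, ← Set.inter_assoc, ← hl, ← hr]
  exact ⟨(Set.inter_assoc ..).symm, (Set.inter_assoc ..).symm⟩

theorem isTopologicalBasis_basicOpen (G : SimpleGraph V) :
    TopologicalSpace.IsTopologicalBasis
      {O | ∃ Z A' B' : Set V, Z.Finite ∧ IsSeparation G Z A' B' ∧ O = basicOpen G Z A' B'} where
  exists_subset_inter := by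
    rintro _ ⟨Z₁, _, _, hZ₁, -, rfl⟩ _ ⟨Z₂, _, _, hZ₂, -, rfl⟩ s ⟨⟨rfl, rfl⟩, rfl, rfl⟩
    exact ⟨_, ⟨Z₁ ∪ Z₂, _, _, hZ₁.union hZ₂, s.isSeparation_inter _, rfl⟩, ⟨rfl, rfl⟩,
      Set.subset_inter (basicOpen_inter_subset Set.subset_union_left _ _)
        (basicOpen_inter_subset Set.subset_union_right _ _)⟩
  sUnion_eq := Set.eq_univ_of_forall fun s =>
    ⟨_, ⟨∅, _, _, Set.finite_empty, s.isSeparation_inter _, rfl⟩, rfl, rfl⟩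
  eq_generateFrom := rfl

theorem FinSep.nhds_hasBasis (s : FinSep G) :
    (𝓝 s).HasBasis Set.Finite fun Z => basicOpen G Z (s.left ∩ Z) (s.right ∩ Z) := by
  refine (isTopologicalBasis_basicOpen G).nhds_hasBasis.to_hasBasis ?_ fun Z hZ =>
    ⟨_, ⟨⟨Z, _, _, hZ, s.isSeparation_inter Z, rfl⟩, rfl, rfl⟩, subset_rfl⟩
  rintro _ ⟨⟨Z, _, _, hZ, -, rfl⟩, rfl, rfl⟩
  exact ⟨Z, hZ, subset_rfl⟩

theorem FinSep.eventually_mem_iff (s : FinSep G) (v : V) :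
    ∀ᶠ s' in 𝓝 s, (v ∈ s'.left ↔ v ∈ s.left) ∧ (v ∈ s'.right ↔ v ∈ s.right) :=
  s.nhds_hasBasis.eventually_iff.2 ⟨{v}, Set.finite_singleton v, fun _ ⟨hl, hr⟩ =>
    ⟨by simpa using Set.ext_iff.1 hl v, by simpa using Set.ext_iff.1 hr v⟩⟩

theorem isClosed_sepsBelow (G : SimpleGraph V) (κ : Cardinal.{u}) : IsClosed (sepsBelow G κ) := by
  refine isClosed_iff_frequently.2 fun s hs => ?_
  obtain ⟨s', hs', hss'⟩ := (hs.and_eventually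
    ((eventually_all_finite s.finite).2 fun v _ => s.eventually_mem_iff v)).exists
  have hsub : s.left ∩ s.right ⊆ s'.left ∩ s'.right := fun v hv =>
    ⟨(hss' v hv).1.2 hv.1, (hss' v hv).2.2 hv.2⟩
  exact (Cardinal.mk_le_mk_of_subset hsub).trans_lt hs'

theorem Dominates.eventually_mem_left_inter_right (hv : Dominates v ω) {s : FinSep G}
    (hs : s ∉ endTangle ω) :
    ∀ᶠ s' in 𝓝 s, s' ∈ endTangle ω → v ∈ s.right ∧ v ∈ s'.left ∩ s'.right :=
  (s.eventually_mem_iff v).mono fun _ h hs' =>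
    ⟨h.2.1 (hv.mem_right hs'), h.1.2 (hv.mem_left hs), hv.mem_right hs'⟩

theorem isClosed_endTangle_of_dom_eq_top (h : dom ω = ⊤) : IsClosed (endTangle ω) := by
  refine isClosed_iff_frequently.2 fun s hfreq => ?_
  by_contra hs
  obtain ⟨v, hv, hvs⟩ := (Set.encard_eq_top_iff.1 h).exists_notMem_finite s.finite
  obtain ⟨s', hs', hvs'⟩ := (hfreq.and_eventually (hv.eventually_mem_left_inter_right hs)).exists
  exact hvs ⟨hv.mem_left hs, (hvs' hs').1⟩

theorem Ray.BelongsTo.eventually_inter_nonempty {R : Ray G} (hR : R.BelongsTo ω) {s : FinSep G}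
    (hs : s ∉ endTangle ω) :
    ∀ᶠ s' in 𝓝 s, s' ∈ endTangle ω →
      (R.verts ∩ ((s'.left ∩ s'.right) \ s.right)).Nonempty := by
  obtain ⟨N, hN⟩ := eventually_atTop.1 (hR.eventually_notMem_right hs)
  refine (s.eventually_mem_iff (R.vert N)).mono fun s' h hs' => ?_
  by_contra! hempty
  have hout (n : ℕ) (hn : N ≤ n) : R.vert n ∉ s'.right := by
    induction n, hn using Nat.le_induction with
    | base => exact fun hr => hN N le_rfl (h.2.1 hr)
    | succ n hn ih =>
      refine fun hr => ih (s'.mem_right_of_adj (fun hl => ?_) (R.adj n).symm)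
      exact Set.eq_empty_iff_forall_notMem.1 hempty _
        ⟨⟨n + 1, rfl⟩, ⟨hl, hr⟩, hN _ (hn.trans n.le_succ)⟩
  obtain ⟨M, hM⟩ := hs' R hR
  exact hout _ (le_max_left N M) (hM _ (le_max_right N M))

theorem encard_le_encard_of_pairwiseDisjoint {ι α : Type*} {F : Set ι} {f : ι → Set α}
    (hF : F.PairwiseDisjoint f) {X : Set α} (hX : ∀ i ∈ F, (f i ∩ X).Nonempty) :
    F.encard ≤ X.encard := by
  choose x hxf hxX using hX
  refine ENat.card_le_card_of_injective (f := fun i : F => (⟨x i i.2, hxX i i.2⟩ : X)) ?_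
  intro i j hij
  have hij' : x i i.2 = x j j.2 := congrArg Subtype.val hij
  exact Subtype.ext (hF.elim_set i.2 j.2 _ (hxf i i.2) (hij' ▸ hxf j j.2))

theorem eventually_encard_add_dom_le {F : Set (Ray G)} (hFfin : F.Finite)
    (hF : ∀ R ∈ F, R.BelongsTo ω) (hFd : F.PairwiseDisjoint Ray.verts) (hdom : dom ω ≠ ⊤)
    {s : FinSep G} (hs : s ∉ endTangle ω) :
    ∀ᶠ s' in 𝓝 s, s' ∈ endTangle ω → F.encard + dom ω ≤ (s'.left ∩ s'.right).encard := by
  have hdom' := (eventually_all_finite (Set.encard_ne_top_iff.1 hdom)).2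
    fun v (hv : Dominates v ω) => hv.eventually_mem_left_inter_right hs
  have hrays := (eventually_all_finite hFfin).2 fun R hR => (hF R hR).eventually_inter_nonempty hs
  filter_upwards [hdom', hrays] with s' hdom' hrays hs'
  rw [← Set.encard_sdiff_add_encard_inter (s'.left ∩ s'.right) s.right]
  exact add_le_add (encard_le_encard_of_pairwiseDisjoint hFd fun R hR => hrays R hR hs')
    (Set.encard_le_encard fun v hv => ⟨(hdom' v hv hs').2, (hdom' v hv hs').1⟩)

theorem exists_encard_eq_of_le_deg {r : ℕ} (h : (r : ℕ∞) ≤ deg ω) :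
    ∃ F : Set (Ray G), (∀ R ∈ F, R.BelongsTo ω) ∧ F.PairwiseDisjoint Ray.verts ∧
      F.encard = r := by
  obtain ⟨F, hF, hFd, hr⟩ : ∃ F : Set (Ray G), (∀ R ∈ F, R.BelongsTo ω) ∧
      F.PairwiseDisjoint Ray.verts ∧ (r : ℕ∞) ≤ F.encard := by
    rcases r with _ | r
    · exact ⟨∅, by simp⟩
    · obtain ⟨_, ⟨F, hF, hFd, rfl⟩, hr⟩ :=
        lt_sSup_iff.1 ((Nat.cast_lt.2 r.lt_succ_self).trans_le h)
      exact ⟨F, hF, hFd, by simpa using Order.add_one_le_of_lt hr⟩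
  obtain ⟨F', hF', hr⟩ := Set.exists_subset_encard_eq hr
  exact ⟨F', fun R hR => hF R (hF' hR), hFd.subset hF', hr⟩

theorem mem_sepsBelow_natCast {s : FinSep G} {k : ℕ} :
    s ∈ sepsBelow G k ↔ (s.left ∩ s.right).encard < k := by
  rw [← Set.toENat_cardinalMk, Cardinal.toENat_lt_natCast]
  rfl

theorem isClosed_endTangle_inter_sepsBelow {k : ℕ} (h : (k : ℕ∞) ≤ deg ω + dom ω) :
    IsClosed (endTangle ω ∩ sepsBelow G k) := by
  by_cases hdom : dom ω = ⊤
  · exact (isClosed_endTangle_of_dom_eq_top hdom).inter (isClosed_sepsBelow G k)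
  obtain ⟨d, hd⟩ := ENat.ne_top_iff_exists.1 hdom
  obtain ⟨F, hF, hFd, hFk⟩ := exists_encard_eq_of_le_deg (ω := ω) (r := k - d)
    (by rw [ENat.natCast_sub, hd]; exact tsub_le_iff_right.2 h)
  refine isClosed_iff_frequently.2 fun s hfreq =>
    ⟨?_, (isClosed_sepsBelow G k).mem_of_frequently_of_tendsto (hfreq.mono fun _ h => h.2)
      tendsto_id⟩
  by_contra hs
  obtain ⟨s', ⟨hs', hk⟩, hle⟩ := (hfreq.and_eventually
    (eventually_encard_add_dom_le (Set.finite_of_encard_eq_coe hFk) hF hFd hdom hs)).exists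
  have hlt := (hle hs').trans_lt (mem_sepsBelow_natCast.1 hk)
  rw [hFk, ← hd] at hlt
  have : k - d + d < k := by exact_mod_cast hlt
  omega

/-- The separation `(V, D)`. If `D` is the set of vertices dominating an end, this is a limit of
separations in its end tangle. -/
def univSep (G : SimpleGraph V) (hD : D.Finite) : FinSep G where
  left := Set.univ
  right := D
  isSeparation := ⟨Set.univ_union D, fun _ _ b hb => absurd (Set.mem_univ b) hb.2⟩
  finite := hD.subset Set.inter_subset_right

theorem univSep_notMem_endTangle (hD : D.Finite) : univSep G hD ∉ endTangle ω := by
  obtain ⟨R, hR⟩ := ω.exists_belongsTo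
  intro h
  obtain ⟨n, hn, hn'⟩ :=
    ((Ray.hasTailIn_iff_eventually.1 (h R hR)).and (R.eventually_notMem hD)).exists
  exact hn' hn

theorem frequently_mem_endTangle (hdom : {v | Dominates v ω}.Finite) :
    ∃ᶠ s in 𝓝 (univSep G hdom),
      s ∈ endTangle ω ∧ (s.left ∩ s.right).encard ≤ deg ω + dom ω := by
  refine (univSep G hdom).nhds_hasBasis.frequently_iff.2 fun {Z} hZ => ?_
  obtain ⟨s, hs, hl, hr, hle⟩ := exists_mem_endTangle_of_finite hdom hZ
  exact ⟨s, ⟨by rw [Set.inter_eq_right.2 hl]; exact Z.univ_inter.symm, hr⟩, hs, hle⟩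

theorem not_isClosed_endTangle_inter (hdom : dom ω ≠ ⊤) {P : Set (FinSep G)}
    (hP : ∀ s : FinSep G, (s.left ∩ s.right).encard ≤ deg ω + dom ω → s ∈ P) :
    ¬ IsClosed (endTangle ω ∩ P) := fun hclosed =>
  univSep_notMem_endTangle _ <| And.left <| isClosed_iff_frequently.1 hclosed _ <|
    (frequently_mem_endTangle (Set.encard_ne_top_iff.1 hdom)).mono fun s hs => ⟨hs.1, hP s hs.2⟩

theorem isClosed_endTangle_iff : IsClosed (endTangle ω) ↔ dom ω = ⊤ := by
  refine ⟨fun h => ?_, isClosed_endTangle_of_dom_eq_top⟩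
  by_contra hdom
  rw [← (endTangle ω).inter_univ] at h
  exact not_isClosed_endTangle_inter hdom (fun s _ => Set.mem_univ s) h

theorem isClosed_endTangle_inter_sepsBelow_iff {k : ℕ} :
    IsClosed (endTangle ω ∩ sepsBelow G k) ↔ (k : ℕ∞) ≤ deg ω + dom ω := by
  refine ⟨fun h => not_lt.1 fun hlt => ?_, isClosed_endTangle_inter_sepsBelow⟩
  have hdom : dom ω ≠ ⊤ := (le_add_self.trans_lt (hlt.trans_le le_top)).ne
  exact not_isClosed_endTangle_inter hdom (fun s hs => mem_sepsBelow_natCast.2 (hs.trans_lt hlt)) h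

theorem sepsBelow_aleph0 (G : SimpleGraph V) : sepsBelow G Cardinal.aleph0 = Set.univ :=
  Set.eq_univ_of_forall fun s => Cardinal.mk_lt_aleph0_iff.2 s.finite

theorem sepsBelow_mono (G : SimpleGraph V) : Monotone (sepsBelow G) :=
  fun _ _ h _ hs => lt_of_lt_of_le hs h

theorem aleph0_lt_aleph_one : Cardinal.aleph0 < Cardinal.aleph 1 :=
  Cardinal.succ_aleph0 ▸ Order.lt_succ Cardinal.aleph0

theorem lt_coh_iff {κ : Cardinal.{u}} (hκ : κ < Cardinal.aleph 1) :
    κ < coh ω ↔ IsClosed (endTangle ω ∩ sepsBelow G κ) := by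
  refine ⟨fun h => ?_, fun h => (Order.lt_succ κ).trans_le <|
    le_csSup ⟨_, fun _ hκ' => hκ'.1⟩ ⟨Order.succ_le_of_lt hκ, fun k hk => ?_⟩⟩
  · obtain ⟨_, ⟨-, hclosed⟩, hlt⟩ := exists_lt_of_lt_csSup' h
    exact hclosed κ hlt
  · rw [← Set.inter_eq_right.2 (sepsBelow_mono G (Order.lt_succ_iff.1 hk)), ← Set.inter_assoc]
    exact h.inter (isClosed_sepsBelow G k)

theorem toENat_coh (ω : Ends G) : Cardinal.toENat (coh ω) = deg ω + dom ω + 1 := by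
  refine ENat.eq_of_forall_natCast_le_iff fun n => ?_
  cases n with
  | zero => simp only [Nat.cast_zero, zero_le]
  | succ n =>
    rw [Nat.cast_succ, ENat.natCast_add_one_le_iff, ENat.natCast_add_one_le_iff,
      Cardinal.natCast_lt_toENat, ENat.natCast_lt_add_one_iff,
      lt_coh_iff (Cardinal.natCast_lt_aleph0.trans aleph0_lt_aleph_one),
      isClosed_endTangle_inter_sepsBelow_iff]

theorem aleph0_lt_coh_iff : Cardinal.aleph0 < coh ω ↔ dom ω = ⊤ := by
  rw [lt_coh_iff aleph0_lt_aleph_one, sepsBelow_aleph0, Set.inter_univ, isClosed_endTangle_iff]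

theorem hasInfiniteCohesion_iff : HasInfiniteCohesion ω ↔ dom ω = ⊤ := by
  have hle : coh ω ≤ Cardinal.aleph 1 := csSup_le' fun _ h => h.1
  rw [HasInfiniteCohesion, ← hle.ge_iff_eq, ← Cardinal.succ_aleph0, Order.succ_le_iff,
    aleph0_lt_coh_iff]

theorem hasUnboundedCohesion_iff :
    HasUnboundedCohesion ω ↔ deg ω + dom ω = ⊤ ∧ dom ω ≠ ⊤ := by
  rw [HasUnboundedCohesion, eq_comm, eq_iff_le_not_lt, aleph0_lt_coh_iff, ← Cardinal.toENat_eq_top,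
    toENat_coh, ENat.add_eq_top, or_iff_left ENat.one_ne_top]

theorem hasBoundedCohesion_iff {k : ℕ} : HasBoundedCohesion ω k ↔ deg ω + dom ω + 1 = k := by
  rw [HasBoundedCohesion, ← Cardinal.toENat_eq_natCast, toENat_coh]

theorem forall_isClosed_endTangle_inter_sepsBelow_iff :
    (∀ k : ℕ, IsClosed (endTangle ω ∩ sepsBelow G k)) ↔ deg ω + dom ω = ⊤ := by
  simp only [isClosed_endTangle_inter_sepsBelow_iff, ENat.eq_top_iff_forall_ge]

end GraphEnd

theorem mainTheorem2 {V : Type u} (G : SimpleGraph V) (ω : GraphEnd.Ends G) :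
    -- (i) infinite cohesion, i.e. the end tangle is closed
    ((GraphEnd.HasInfiniteCohesion ω ↔ GraphEnd.dom ω = ⊤) ∧
      (IsClosed (GraphEnd.endTangle ω) ↔ GraphEnd.dom ω = ⊤)) ∧
    -- (ii) unbounded cohesion, i.e. the end tangle is not closed but all its restrictions are
    ((GraphEnd.HasUnboundedCohesion ω ↔ GraphEnd.deg ω = ⊤ ∧ GraphEnd.dom ω < ⊤) ∧
      ((¬ IsClosed (GraphEnd.endTangle ω) ∧
          ∀ k : ℕ, IsClosed (GraphEnd.endTangle ω ∩ GraphEnd.sepsBelow G k)) ↔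
        GraphEnd.deg ω = ⊤ ∧ GraphEnd.dom ω < ⊤)) ∧
    -- (iii) bounded cohesion `k`
    (∀ k : ℕ, GraphEnd.HasBoundedCohesion ω k ↔
      GraphEnd.deg ω + GraphEnd.dom ω + 1 = (k : ℕ∞)) := by
  have hsum : GraphEnd.deg ω + GraphEnd.dom ω = ⊤ ∧ GraphEnd.dom ω ≠ ⊤ ↔
      GraphEnd.deg ω = ⊤ ∧ GraphEnd.dom ω < ⊤ := by
    rw [ENat.add_eq_top, lt_top_iff_ne_top]
    tauto
  refine ⟨⟨GraphEnd.hasInfiniteCohesion_iff, GraphEnd.isClosed_endTangle_iff⟩,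
    ⟨GraphEnd.hasUnboundedCohesion_iff.trans hsum, ?_⟩, fun k => GraphEnd.hasBoundedCohesion_iff⟩
  rw [GraphEnd.isClosed_endTangle_iff, GraphEnd.forall_isClosed_endTangle_inter_sepsBelow_iff,
    and_comm, ← ne_eq, hsum]
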